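/- All groups are finite, and characters are complex characters. Let $\mathrm{Irr}(G)$ be the set of irreducible characters of a finite group $G$. For a positive multiple $n$ of $|G|$ let $\mathbb{Q}_n\subseteq\mathbb{C}$ be the $n$-th cyclotomic field; $\mathrm{Gal}(\mathbb{Q}_n|\mathbb{Q})$ acts on $\mathrm{Irr}(G)$ by $\chi^{\alpha}(g)=\chi(g)^{\alpha}$. Two characters $\chi,\psi\in\mathrm{Irr}(G)$ are called Galois conjugate if $\chi^{\alpha}=\psi$ for some such $n$ and some $\alpha\in\mathrm{Gal}(\mathbb{Q}_n|\mathbb{Q})$ (this does not depend on the choice of $n$). A finite group $G$ is called a $\mathbf{GC}^{*}$-group if any two non-linear (i.e. of degree $\chi(1)\neq 1$) irreducible characters of $G$ that have the same degree are Galois conjugate. Corollary. Let $G$ be a finite nilpotent $\mathbf{GC}^{*}$-group. Then either $G$ is abelian, or $G$ is a $p$-group for some prime $p$, the centre of $G$ is cyclic, and the commutator subgroup of $G$ has prime order. -/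

import Mathlib

/-- `χ` is an irreducible complex character of `G`: the trace of an irreducible complex
representation of `G` of finite dimension `d` (realised, without loss of generality, on `ℂ^d`). -/
def IsIrrChar {G : Type*} [Group G] (χ : G → ℂ) : Prop :=
  ∃ (d : ℕ) (ρ : Representation ℂ G (Fin d → ℂ)), ρ.IsIrreducible ∧ ρ.character = χ

/-- The `n`-th cyclotomic field `ℚ_n`, as the subfield of `ℂ` generated by the complex `n`-th
roots of unity (used for `n ≠ 0` only). -/
noncomputable def cyclotomicSubfield (n : ℕ) : IntermediateField ℚ ℂ :=
  IntermediateField.adjoin ℚ {z : ℂ | z ^ n = 1}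

/-- `χ` and `ψ` are Galois conjugate in `Gal(ℚ_n | ℚ)`: some automorphism `α` of `ℚ_n` satisfies
`χ(g)^α = ψ(g)` for all `g` (in particular the values of `χ` and `ψ` lie in `ℚ_n`). -/
def GaloisConjugateIn {G : Type*} (n : ℕ) (χ ψ : G → ℂ) : Prop :=
  ∃ α : cyclotomicSubfield n ≃ₐ[ℚ] cyclotomicSubfield n,
    ∀ g : G, ∃ x : cyclotomicSubfield n, (x : ℂ) = χ g ∧ (α x : ℂ) = ψ g

/-- `χ` and `ψ` are Galois conjugate: they are so in `Gal(ℚ_n | ℚ)` for some positive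
multiple `n` of `|G|`. -/
def GaloisConjugate {G : Type*} (χ ψ : G → ℂ) : Prop :=
  ∃ n : ℕ, 0 < n ∧ Nat.card G ∣ n ∧ GaloisConjugateIn n χ ψ

/-- `G` is a `GC*`-group: any two non-linear (that is, of degree `χ(1) ≠ 1`) irreducible
characters of `G` of the same degree are Galois conjugate. -/
def IsGCStar (G : Type*) [Group G] : Prop :=
  ∀ χ ψ : G → ℂ, IsIrrChar χ → IsIrrChar ψ → χ 1 ≠ 1 → ψ 1 ≠ 1 → χ 1 = ψ 1 →
    GaloisConjugate χ ψ

open scoped commutatorElement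

/-! An automorphism of a cyclotomic field acts on roots of unity as a power map. Hence in a
GC*-group two nonlinear irreducible characters of equal degree are related by ψ(g) = χ(g ^ k) with k
prime to |G| (`SameDegreePowerConj`), a property that passes to quotients. Irreducibility is used
throughout in Burnside's form: the matrices ρ(g) span the full matrix algebra.

Every normal subgroup N is comparable with G'. If N does not contain G', inflate a nonlinear
character from G/N; a linear twist has the same degree, so it is a power conjugate and is also
trivial on N. Thus all linear characters are trivial on N, and N ≤ G'. With nilpotency this forces a
nonabelian G to be a p-group.

To get |G'| = p, induct on |G|. Take M central of order p. If G' is not inside M, then M ≤ G' and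
|(G/M)'| = p. Put |Z(G/M)| = p^t; all nonlinear characters of G/M have one degree p^n, with p^(2n)
p^t = |G/M|. The characters of G nontrivial on M have squared degrees summing to at least (p-1)
p^(t+2n). But these degrees are powers p^a with a < n, and each occurs at most φ(exp G) ≤ p^(t+1)
(p-1) times, so the sum is too small (`false_of_card_commutator_quotient`).

Once |G'| = p, comparability puts every central element of order p in G', so the centre is cyclic.
-/

/-! ### Matrix representations with spanning image -/

open Matrix in
theorem isIrrChar_trace_of_span_eq_top {G : Type*} [Group G] {d : ℕ} [NeZero d]
    {ρ : G →* Matrix (Fin d) (Fin d) ℂ} (hρ : Submodule.span ℂ (Set.range ρ) = ⊤) :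
    IsIrrChar fun g ↦ (ρ g).trace := by
  let σ : Representation ℂ G (Fin d → ℂ) :=
    ((Matrix.toLinAlgEquiv' : Matrix (Fin d) (Fin d) ℂ ≃ₐ[ℂ] _) :
      Matrix (Fin d) (Fin d) ℂ →* ((Fin d → ℂ) →ₗ[ℂ] (Fin d → ℂ))).comp ρ
  have hσ (g : G) : σ g = Matrix.toLin' (ρ g) := rfl
  refine ⟨d, σ, ?_, ?_⟩
  · have hW (W : Subrepresentation σ) : W = ⊥ ∨ W = ⊤ := by
      by_cases h : W.toSubmodule = ⊥
      · exact Or.inl (Subrepresentation.toSubmodule_injective h)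
      refine Or.inr (Subrepresentation.toSubmodule_injective (eq_top_iff.2 fun w _ ↦ ?_))
      obtain ⟨v, hv, hv0⟩ := (Submodule.ne_bot_iff _).1 h
      obtain ⟨i, hi⟩ := Function.ne_iff.1 hv0
      have key (A : Matrix (Fin d) (Fin d) ℂ) : A *ᵥ v ∈ W.toSubmodule := by
        have hA : A ∈ Submodule.span ℂ (Set.range ρ) := hρ ▸ Submodule.mem_top
        induction hA using Submodule.span_induction with
        | mem x hx =>
          obtain ⟨g, rfl⟩ := hx
          exact W.apply_mem_toSubmodule g hv
        | zero => simp
        | add x y _ _ hx hy => rw [add_mulVec]; exact add_mem hx hy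
        | smul a x _ hx => rw [smul_mulVec]; exact Submodule.smul_mem _ a hx
      -- A rank-one matrix sending `v` to the arbitrary vector `w`.
      have := key (vecMulVec w (Pi.single i (v i)⁻¹))
      rwa [vecMulVec_mulVec, single_dotProduct, inv_mul_cancel₀ hi, MulOpposite.op_one,
        one_smul] at this
    exact
      { exists_pair_ne := ⟨⊥, ⊤, fun h ↦ bot_ne_top (congrArg Subrepresentation.toSubmodule h)⟩
        eq_bot_or_eq_top := hW }
  · funext g
    simp [Representation.character, hσ]

theorem exists_eq_smul_one_of_commute {G : Type*} [Group G] {d : ℕ}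
    {ρ : G →* Matrix (Fin d) (Fin d) ℂ} (hρ : Submodule.span ℂ (Set.range ρ) = ⊤)
    {A : Matrix (Fin d) (Fin d) ℂ} (hA : ∀ g, Commute (ρ g) A) : ∃ c : ℂ, A = c • 1 := by
  have key (B : Matrix (Fin d) (Fin d) ℂ) : Commute B A := by
    have hB : B ∈ Submodule.span ℂ (Set.range ρ) := hρ ▸ Submodule.mem_top
    induction hB using Submodule.span_induction with
    | mem x hx =>
      obtain ⟨g, rfl⟩ := hx
      exact hA g
    | zero => exact Commute.zero_left A
    | add x y _ _ hx hy => exact hx.add_left hy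
    | smul a x _ hx => exact hx.smul_left a
  obtain ⟨c, hc⟩ := Matrix.mem_range_scalar_of_commute_single (M := A) fun i j _ ↦ key _
  exact ⟨c, by rw [← hc, Matrix.scalar_apply, Matrix.smul_one_eq_diagonal]⟩

/-- Coset representatives of `K` already span the matrix algebra, since elements of `K` only
contribute scalars. -/
theorem sq_le_index_of_forall_scalar {G : Type*} [Group G] [Finite G] {d : ℕ}
    {ρ : G →* Matrix (Fin d) (Fin d) ℂ} (hρ : Submodule.span ℂ (Set.range ρ) = ⊤)
    {K : Subgroup G} (hK : ∀ k ∈ K, ∃ c : ℂ, ρ k = c • 1) : d ^ 2 ≤ K.index := by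
  classical
  have := Fintype.ofFinite (G ⧸ K)
  have h : Submodule.span ℂ (Set.range fun q : G ⧸ K ↦ ρ q.out) = ⊤ := by
    rw [eq_top_iff, ← hρ, Submodule.span_le]
    rintro _ ⟨g, rfl⟩
    obtain ⟨k, hk⟩ := QuotientGroup.mk_out_eq_mul K g
    obtain ⟨c, hc⟩ := hK k⁻¹ (inv_mem k.2)
    have : ρ g = c • ρ (g : G ⧸ K).out := by
      rw [← mul_inv_eq_iff_eq_mul] at hk
      rw [← hk, map_mul, hc, hk]
      simp
    rw [this]
    exact Submodule.smul_mem _ _ (Submodule.subset_span ⟨_, rfl⟩)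
  have h2 := finrank_range_le_card (R := ℂ) fun q : G ⧸ K ↦ ρ q.out
  rw [Set.finrank, h, finrank_top, Module.finrank_matrix, Fintype.card_fin, Module.finrank_self, mul_one,
    ← Nat.card_eq_fintype_card] at h2
  rwa [sq]

/-- Averaging `X` over conjugation gives a scalar determined by its trace; matrix units `X` then
give the Schur relations for diagonal entries. -/
theorem sum_trace_mul_trace_inv {G : Type*} [Group G] [Fintype G] {d : ℕ} [NeZero d]
    {ρ : G →* Matrix (Fin d) (Fin d) ℂ} (hρ : Submodule.span ℂ (Set.range ρ) = ⊤) :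
    ∑ g, (ρ g).trace * (ρ g⁻¹).trace = Fintype.card G := by
  have key (X : Matrix (Fin d) (Fin d) ℂ) :
      ∑ g, ρ g * X * ρ g⁻¹ = (Fintype.card G * X.trace / d : ℂ) • 1 := by
    obtain ⟨c, hc⟩ := exists_eq_smul_one_of_commute hρ (A := ∑ g, ρ g * X * ρ g⁻¹) fun h ↦ by
      rw [commute_iff_eq, Finset.mul_sum, Finset.sum_mul]
      refine Fintype.sum_equiv (Equiv.mulLeft h) _ _ fun g ↦ ?_
      have : ρ h⁻¹ * ρ h = 1 := by rw [← map_mul, inv_mul_cancel, map_one]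
      simp [mul_assoc, this]
    have ht := congrArg Matrix.trace hc
    have h1 (g : G) : (ρ g * X * ρ g⁻¹).trace = X.trace := by
      rw [Matrix.trace_mul_comm, ← mul_assoc, ← map_mul]
      simp
    simp only [Matrix.trace_sum, h1, Finset.sum_const, Finset.card_univ, nsmul_eq_mul,
      Matrix.trace_smul, Matrix.trace_one, Fintype.card_fin, smul_eq_mul] at ht
    rw [hc, ht, mul_div_cancel_right₀ _ (NeZero.ne _)]
  have h2 (i j : Fin d) : ∑ g, ρ g i i * ρ g⁻¹ j j =
      if i = j then (Fintype.card G / d : ℂ) else 0 := by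
    have := congrFun (congrFun (key (Matrix.single i j 1)) i) j
    simp only [Matrix.sum_apply, Matrix.smul_apply, Matrix.one_apply] at this
    have hs (g : G) : (ρ g * Matrix.single i j 1 * ρ g⁻¹ : Matrix (Fin d) (Fin d) ℂ) i j = ρ g i i * ρ g⁻¹ j j := by
      rw [Matrix.mul_apply, Finset.sum_eq_single j]
      · simp
      · intro b _ hb
        rw [Matrix.mul_single_apply_of_ne (hbj := hb), zero_mul]
      · simp
    simp only [hs] at this
    split_ifs with h
    · subst h; simpa using this
    · simpa [h] using this
  calc ∑ g, (ρ g).trace * (ρ g⁻¹).trace = ∑ i, ∑ j, ∑ g, ρ g i i * ρ g⁻¹ j j := by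
        simp only [Matrix.trace, Matrix.diag_apply, Finset.sum_mul_sum]
        rw [Finset.sum_comm]
        exact Finset.sum_congr rfl fun i _ ↦ Finset.sum_comm
    _ = Fintype.card G := by
        simp only [h2, Finset.sum_ite_eq, Finset.mem_univ, if_true, Finset.sum_const,
          Finset.card_univ, Fintype.card_fin, nsmul_eq_mul]
        exact mul_div_cancel₀ _ (NeZero.ne _)

/-! ### Character values as sums of roots of unity -/

/-- `A` is diagonalisable because X^e - 1 is separable; `s` is its spectrum and `r` the
multiplicities. The same data serve every `k`, which turns Galois action into a power map. -/
theorem trace_pow_eq_sum_of_pow_eq_one {d e : ℕ} (he : 0 < e) {A : Matrix (Fin d) (Fin d) ℂ}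
    (hA : A ^ e = 1) : ∃ (s : Finset ℂ) (r : ℂ → ℕ), (∀ z ∈ s, z ^ e = 1) ∧
      ∀ k : ℕ, (A ^ k).trace = ∑ z ∈ s, r z * z ^ k := by
  classical
  set f : Module.End ℂ (Fin d → ℂ) := Matrix.toLinAlgEquiv' A with hf
  have hfe : f ^ e = 1 := by rw [hf, ← map_pow, hA, map_one]
  have hss : f.IsSemisimple := by
    refine Module.End.isSemisimple_of_squarefree_aeval_eq_zero
      (p := Polynomial.X ^ e - Polynomial.C 1) ?_ (by simp [hfe])
    exact (Polynomial.separable_X_pow_sub_C (1 : ℂ) (by exact_mod_cast he.ne')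
      one_ne_zero).squarefree
  have hint : DirectSum.IsInternal f.eigenspace :=
    DirectSum.isInternal_submodule_of_iSupIndep_of_iSup_eq_top f.eigenspaces_iSupIndep
      hss.iSup_eigenspace_eq_top
  have hfin : {z | f.eigenspace z ≠ ⊥}.Finite :=
    WellFoundedGT.finite_ne_bot_of_iSupIndep f.eigenspaces_iSupIndep
  have hpow (z : ℂ) (k : ℕ) {v : Fin d → ℂ} (hv : v ∈ f.eigenspace z) :
      (f ^ k) v = z ^ k • v := by
    rw [Module.End.mem_eigenspace_iff] at hv
    induction k with
    | zero => simp
    | succ k ih => rw [pow_succ', Module.End.mul_apply, ih, map_smul, hv, smul_smul, pow_succ]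
  refine ⟨hfin.toFinset, fun z ↦ Module.finrank ℂ (f.eigenspace z), fun z hz ↦ ?_, fun k ↦ ?_⟩
  · obtain ⟨v, hv, hv0⟩ := (Submodule.ne_bot_iff _).1 (hfin.mem_toFinset.1 hz)
    have := hpow z e hv
    rw [hfe, Module.End.one_apply] at this
    exact smul_left_injective ℂ hv0 (by simpa using this.symm)
  · have hm (z : ℂ) : Set.MapsTo (f ^ k) (f.eigenspace z) (f.eigenspace z) := fun v hv ↦ by
      rw [SetLike.mem_coe] at hv ⊢
      rw [hpow z k hv]
      exact Submodule.smul_mem _ _ hv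
    have h1 : (A ^ k).trace = LinearMap.trace ℂ _ (f ^ k) := by
      rw [hf, ← map_pow]
      exact (Matrix.trace_toLin'_eq (A ^ k)).symm
    rw [h1, LinearMap.trace_eq_sum_trace_restrict' hint hfin hm]
    refine Finset.sum_congr rfl fun z _ ↦ ?_
    have : (f ^ k).restrict (hm z) = z ^ k • 1 := by
      exact LinearMap.ext fun v ↦ Subtype.ext (hpow z k v.2)
    rw [this, map_smul, Module.End.one_eq_id, LinearMap.trace_id, smul_eq_mul, mul_comm]

theorem GaloisConjugate.exists_coprime_forall_eq_trace_pow {G : Type*} [Group G] [Finite G] {d : ℕ}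
    {ρ : G →* Matrix (Fin d) (Fin d) ℂ} {ψ : G → ℂ}
    (h : GaloisConjugate (fun g ↦ (ρ g).trace) ψ) :
    ∃ k : ℕ, k.Coprime (Nat.card G) ∧ ∀ g, ψ g = (ρ (g ^ k)).trace := by
  obtain ⟨n, hn, hdvd, α, hα⟩ := h
  have : NeZero n := ⟨hn.ne'⟩
  have hmem {z : ℂ} (hz : z ^ n = 1) : z ∈ cyclotomicSubfield n :=
    IntermediateField.subset_adjoin _ _ hz
  obtain ⟨ζ, hζ⟩ : ∃ ζ : cyclotomicSubfield n, IsPrimitiveRoot ζ n := by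
    have hζ := Complex.isPrimitiveRoot_exp n hn.ne'
    exact ⟨⟨_, hmem hζ.pow_eq_one⟩, IsPrimitiveRoot.coe_submonoidClass_iff.1 hζ⟩
  set u := hζ.autToPow ℚ α
  refine ⟨(u : ZMod n).val, (ZMod.val_coe_unit_coprime u).coprime_dvd_right hdvd, fun g ↦ ?_⟩
  have hroot (x : cyclotomicSubfield n) (hx : x ^ n = 1) : α x = x ^ (u : ZMod n).val := by
    obtain ⟨i, -, rfl⟩ := hζ.eq_pow_of_pow_eq_one hx
    rw [map_pow, ← hζ.autToPow_spec ℚ α, pow_right_comm]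
  obtain ⟨s, r, hs, hk⟩ := trace_pow_eq_sum_of_pow_eq_one Nat.card_pos (A := ρ g)
    (by rw [← map_pow, pow_card_eq_one', map_one])
  have hs' (z : ℂ) (hz : z ∈ s) : z ^ n = 1 := by
    obtain ⟨m, rfl⟩ := hdvd
    rw [pow_mul, hs z hz, one_pow]
  obtain ⟨x, hx, hx'⟩ := hα g
  have hxe : x = ∑ z ∈ s.attach, (r z : cyclotomicSubfield n) * ⟨z, hmem (hs' z z.2)⟩ := by
    apply Subtype.ext
    have h1 := hk 1
    simp only [pow_one] at h1
    refine hx.trans (h1.trans ?_)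
    rw [← Finset.sum_attach]
    push_cast
    rfl
  rw [← hx', hxe, map_pow, hk, ← Finset.sum_attach s, map_sum]
  push_cast
  refine Finset.sum_congr rfl fun z _ ↦ ?_
  rw [map_mul, map_natCast, hroot _ (Subtype.ext (hs' z z.2))]
  push_cast
  rfl

/-- The sum of χ(g⁻¹) ρ(g) is a scalar c with c d = |G|. It is the image of an element of the group
ring over the algebraic integers, so c is integral and rational. -/
theorem dvd_card_of_span_eq_top {G : Type*} [Group G] [Finite G] {d : ℕ} [NeZero d]
    {ρ : G →* Matrix (Fin d) (Fin d) ℂ} (hρ : Submodule.span ℂ (Set.range ρ) = ⊤) :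
    d ∣ Nat.card G := by
  have := Fintype.ofFinite G
  let R := integralClosure ℤ ℂ
  have hint (g : G) : (ρ g).trace ∈ R := by
    obtain ⟨s, r, hs, hk⟩ := trace_pow_eq_sum_of_pow_eq_one Nat.card_pos (A := ρ g)
      (by rw [← map_pow, pow_card_eq_one', map_one])
    have h1 := hk 1
    simp only [pow_one] at h1
    rw [h1]
    refine sum_mem fun z hz ↦ mul_mem (natCast_mem R _) ?_
    refine IsIntegral.of_pow (n := Nat.card G) Nat.card_pos ?_
    rw [hs z hz]
    exact isIntegral_one
  let F : MonoidAlgebra R G →ₐ[R] Matrix (Fin d) (Fin d) ℂ := MonoidAlgebra.lift R _ G ρ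
  let a : MonoidAlgebra R G := ∑ g, MonoidAlgebra.single g ⟨_, hint g⁻¹⟩
  have hF : F a = ∑ g, (ρ g⁻¹).trace • ρ g := by
    simp only [F, a, map_sum, MonoidAlgebra.lift_single]
    rfl
  obtain ⟨c, hc⟩ := exists_eq_smul_one_of_commute hρ (A := F a) fun h ↦ by
    rw [hF, commute_iff_eq, Finset.mul_sum, Finset.sum_mul]
    refine Fintype.sum_equiv (MulAut.conj h).toEquiv _ _ fun g ↦ ?_
    have : (ρ (h * g * h⁻¹)⁻¹).trace = (ρ g⁻¹).trace := by
      rw [show (h * g * h⁻¹)⁻¹ = h * g⁻¹ * h⁻¹ by group, map_mul, Matrix.trace_mul_comm, ← map_mul]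
      simp
    simp only [MulEquiv.toEquiv_eq_coe, EquivLike.coe_coe, MulAut.conj_apply, this,
      Matrix.mul_smul, Matrix.smul_mul, ← map_mul, inv_mul_cancel_right]
  have hcd : c * d = Nat.card G := by
    have h1 := congrArg Matrix.trace hc
    rw [hF, Matrix.trace_sum, Matrix.trace_smul, Matrix.trace_one, Fintype.card_fin,
      smul_eq_mul] at h1
    rw [← h1, Nat.card_eq_fintype_card, ← sum_trace_mul_trace_inv hρ]
    exact Finset.sum_congr rfl fun g _ ↦ by rw [Matrix.trace_smul, smul_eq_mul, mul_comm]
  have hcR : IsIntegral R c := by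
    have h1 : IsIntegral R (F a) := (IsIntegral.of_finite R a).map F
    rw [hc] at h1
    have h2 : c • (1 : Matrix (Fin d) (Fin d) ℂ) = algebraMap ℂ _ c :=
      (Algebra.algebraMap_eq_smul_one c).symm
    rw [h2] at h1
    exact (isIntegral_algebraMap_iff (algebraMap ℂ (Matrix (Fin d) (Fin d) ℂ)).injective).1 h1
  have hcZ : IsIntegral ℤ c := isIntegral_trans c hcR
  have hd : (d : ℂ) ≠ 0 := NeZero.ne _
  obtain ⟨m, hm⟩ := IsIntegrallyClosed.isIntegral_iff (R := ℤ) (K := ℚ)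
    (x := (Nat.card G : ℚ) / d) |>.1 (by
      rw [← isIntegral_algebraMap_iff (algebraMap ℚ ℂ).injective]
      convert hcZ
      rw [map_div₀, map_natCast, map_natCast, ← hcd, mul_div_cancel_right₀ _ hd])
  have hd' : (d : ℚ) ≠ 0 := NeZero.ne _
  rw [eq_div_iff hd'] at hm
  exact Int.natCast_dvd_natCast.1 ⟨m, by rw [eq_intCast] at hm; rw [mul_comm]; exact_mod_cast hm.symm⟩

/-! ### Wedderburn decomposition of the group algebra -/

theorem MonoidAlgebra.span_range_of_eq_top (k G : Type*) [CommSemiring k] [Monoid G] :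
    Submodule.span k (Set.range (MonoidAlgebra.of k G)) = ⊤ := by
  refine eq_top_iff.2 fun x _ ↦ ?_
  induction x using MonoidAlgebra.induction_on with
  | of g => exact Submodule.subset_span ⟨g, rfl⟩
  | add x y hx hy => exact add_mem (hx trivial) (hy trivial)
  | smul c x hx => exact Submodule.smul_mem _ c (hx trivial)

/-- The blocks of the group algebra. For the last clause, the blocks in `S` are jointly spanned by
the images of coset representatives of `N`. -/
theorem exists_complete_irreducible_family (G : Type*) [Group G] [Finite G] :
    ∃ (m : ℕ) (d : Fin m → ℕ) (ρ : ∀ i, G →* Matrix (Fin (d i)) (Fin (d i)) ℂ),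
      (∀ i, NeZero (d i)) ∧ (∀ i, Submodule.span ℂ (Set.range (ρ i)) = ⊤) ∧
      (∀ i j, (∀ g, (ρ i g).trace = (ρ j g).trace) → i = j) ∧
      ∑ i, d i ^ 2 = Nat.card G ∧
      ∀ (N : Subgroup G) (S : Finset (Fin m)), (∀ i ∈ S, N ≤ (ρ i).ker) →
        ∑ i ∈ S, d i ^ 2 ≤ N.index := by
  classical
  have := Fintype.ofFinite G
  obtain ⟨m, d, hd, ⟨e⟩⟩ :=
    IsSemisimpleRing.exists_algEquiv_pi_matrix_of_isAlgClosed ℂ (MonoidAlgebra ℂ G)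
  let ρ (i : Fin m) : G →* Matrix (Fin (d i)) (Fin (d i)) ℂ :=
    (((Pi.evalAlgHom ℂ _ i).comp e.toAlgHom : _ →ₐ[ℂ] Matrix (Fin (d i)) (Fin (d i)) ℂ) :
      MonoidAlgebra ℂ G →* Matrix (Fin (d i)) (Fin (d i)) ℂ).comp (MonoidAlgebra.of ℂ G)
  have hρ (i : Fin m) (g : G) : ρ i g = e (MonoidAlgebra.of ℂ G g) i := rfl
  have hspan {V : Type} [AddCommGroup V] [Module ℂ V]
      (L : (Π i, Matrix (Fin (d i)) (Fin (d i)) ℂ) →ₗ[ℂ] V) (hL : Function.Surjective L) :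
      Submodule.span ℂ (Set.range fun g ↦ L (e (MonoidAlgebra.of ℂ G g))) = ⊤ := by
    have h1 : (Set.range fun g ↦ L (e (MonoidAlgebra.of ℂ G g))) =
        (L ∘ₗ e.toLinearMap) '' Set.range (MonoidAlgebra.of ℂ G) := by
      rw [← Set.range_comp]
      rfl
    rw [h1, Submodule.span_image, MonoidAlgebra.span_range_of_eq_top, Submodule.map_top,
      LinearMap.range_eq_top]
    exact hL.comp e.surjective
  refine ⟨m, d, ρ, hd, fun i ↦ ?_, fun i j hij ↦ ?_, ?_, fun N S hS ↦ ?_⟩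
  · exact hspan (LinearMap.proj i) (LinearMap.proj_surjective i)
  · by_contra hne
    have key (x : MonoidAlgebra ℂ G) : (e x i).trace = (e x j).trace := by
      induction x using MonoidAlgebra.induction_on with
      | of g => exact hij g
      | add x y hx hy => simp [hx, hy]
      | smul c x hx => simp [hx]
    -- The central idempotent of block `i` has trace `d i` there and 0 in block `j`.
    have := key (e.symm (Pi.single i 1))
    simp [Pi.single_eq_of_ne' hne] at this
    exact NeZero.ne _ this
  · have h1 := e.toLinearEquiv.finrank_eq
    have h2 : Module.finrank ℂ (MonoidAlgebra ℂ G) = Nat.card G := by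
      rw [Nat.card_eq_fintype_card]
      rw [(MonoidAlgebra.coeffLinearEquiv ℂ (S := ℂ) (M := G)).finrank_eq, Module.finrank_finsupp_self]
    rw [← h2, h1, Module.finrank_pi_fintype]
    simp [Module.finrank_matrix, sq]
  · have := Fintype.ofFinite (G ⧸ N)
    let L : (Π i, Matrix (Fin (d i)) (Fin (d i)) ℂ) →ₗ[ℂ]
        (Π i : S, Matrix (Fin (d i)) (Fin (d i)) ℂ) := LinearMap.pi fun i ↦ LinearMap.proj i.1
    have hL : Function.Surjective L := fun y ↦
      ⟨fun i ↦ if h : i ∈ S then y ⟨i, h⟩ else 0, funext fun i ↦ dif_pos i.2⟩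
    have hq (g : G) : L (e (MonoidAlgebra.of ℂ G (g : G ⧸ N).out)) = L (e (MonoidAlgebra.of ℂ G g)) := by
      obtain ⟨k, hk⟩ := QuotientGroup.mk_out_eq_mul N g
      funext i
      change ρ i (g : G ⧸ N).out = ρ i g
      rw [hk, map_mul, (hS i i.2 k.2 : ρ i k = 1), mul_one]
    have h1 : (Set.range fun g ↦ L (e (MonoidAlgebra.of ℂ G g))) ⊆
        Set.range fun q : G ⧸ N ↦ L (e (MonoidAlgebra.of ℂ G q.out)) := by
      rintro _ ⟨g, rfl⟩
      exact ⟨g, hq g⟩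
    have h2 := finrank_range_le_card (R := ℂ) fun q : G ⧸ N ↦ L (e (MonoidAlgebra.of ℂ G q.out))
    rw [Set.finrank, top_unique ((hspan L hL).symm.le.trans (Submodule.span_mono h1)), finrank_top,
      Module.finrank_pi_fintype, ← Nat.card_eq_fintype_card] at h2
    rw [← Finset.sum_coe_sort, Subgroup.index]
    simpa [Module.finrank_matrix, sq, -Nat.card_eq_fintype_card] using h2

theorem commutator_le_ker_of_eq_one {G : Type*} [Group G] {d : ℕ} (hd : d = 1)
    (ρ : G →* Matrix (Fin d) (Fin d) ℂ) : commutator G ≤ ρ.ker := by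
  rw [commutator_def, Subgroup.commutator_le]
  intro a _ b _
  have hc : ρ a * ρ b = ρ b * ρ a := by
    have : Subsingleton (Fin d) := by rw [hd]; infer_instance
    ext x y
    rw [Matrix.mul_apply, Matrix.mul_apply]
    refine Finset.sum_congr rfl fun z _ ↦ ?_
    rw [Subsingleton.elim z x, Subsingleton.elim y x, mul_comm]
  rw [MonoidHom.mem_ker, commutatorElement_def, map_mul, map_mul, map_mul, hc, mul_assoc (ρ b),
    ← map_mul ρ a, mul_inv_cancel, map_one, mul_one, ← map_mul, mul_inv_cancel, map_one]

theorem exists_irreducible_ne_one_of_commutator_ne_bot {G : Type*} [Group G] [Finite G]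
    (hG : commutator G ≠ ⊥) : ∃ (d : ℕ) (ρ : G →* Matrix (Fin d) (Fin d) ℂ),
      NeZero d ∧ d ≠ 1 ∧ Submodule.span ℂ (Set.range ρ) = ⊤ := by
  obtain ⟨m, d, ρ, hd, hρ, -, hsum, hN⟩ := exists_complete_irreducible_family G
  by_contra! h
  have h1 (i : Fin m) : d i = 1 := by
    by_contra h1
    exact h (d i) (ρ i) (hd i) h1 (hρ i)
  have h2 (i : Fin m) : commutator G ≤ (ρ i).ker := commutator_le_ker_of_eq_one (h1 i) (ρ i)
  have h3 := hN (commutator G) Finset.univ fun i _ ↦ h2 i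
  rw [hsum, ← (commutator G).card_mul_index] at h3
  have h4 : Nat.card (commutator G) ≤ 1 :=
    Nat.le_of_mul_le_mul_right (by simpa using h3) (Nat.pos_of_ne_zero (commutator G).index_ne_zero_of_finite)
  exact hG (Subgroup.eq_bot_of_card_le _ h4)

/-! ### Power conjugacy, quotients and comparability with G' -/

theorem span_range_comp_eq_top {G H : Type*} [Group G] [Group H] {d : ℕ}
    {ρ : H →* Matrix (Fin d) (Fin d) ℂ} (hρ : Submodule.span ℂ (Set.range ρ) = ⊤)
    {f : G →* H} (hf : Function.Surjective f) :
    Submodule.span ℂ (Set.range (ρ.comp f)) = ⊤ := by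
  rwa [MonoidHom.coe_comp, hf.range_comp]

/-- Any two irreducible matrix representations of the same degree `d ≠ 1` have characters which
differ by a power map `g ↦ g ^ k` with `k` prime to the group order. -/
def SameDegreePowerConj (G : Type*) [Group G] : Prop :=
  ∀ (d : ℕ) (ρ σ : G →* Matrix (Fin d) (Fin d) ℂ), NeZero d → d ≠ 1 →
    Submodule.span ℂ (Set.range ρ) = ⊤ → Submodule.span ℂ (Set.range σ) = ⊤ →
      ∃ k : ℕ, k.Coprime (Nat.card G) ∧ ∀ g, (σ g).trace = (ρ (g ^ k)).trace

theorem IsGCStar.sameDegreePowerConj {G : Type*} [Group G] [Finite G] (h : IsGCStar G) :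
    SameDegreePowerConj G := by
  intro d ρ σ _ hd hρ hσ
  refine (h _ _ (isIrrChar_trace_of_span_eq_top hρ) (isIrrChar_trace_of_span_eq_top hσ)
    ?_ ?_ ?_).exists_coprime_forall_eq_trace_pow <;> simp [hd]

theorem SameDegreePowerConj.quotient {G : Type*} [Group G] [Finite G] (h : SameDegreePowerConj G)
    (N : Subgroup G) [N.Normal] : SameDegreePowerConj (G ⧸ N) := by
  intro d ρ σ h0 hd hρ hσ
  have hs := QuotientGroup.mk'_surjective N
  obtain ⟨k, hk, hk'⟩ := h d _ _ h0 hd (span_range_comp_eq_top hρ hs) (span_range_comp_eq_top hσ hs)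
  refine ⟨k, hk.coprime_dvd_right N.card_quotient_dvd_card, fun q ↦ ?_⟩
  obtain ⟨g, rfl⟩ := hs q
  simpa using hk' g

theorem commutator_quotient_eq_map {G : Type*} [Group G] (N : Subgroup G) [N.Normal] :
    commutator (G ⧸ N) = (commutator G).map (QuotientGroup.mk' N) := by
  rw [commutator_def, commutator_def, Subgroup.map_commutator,
    Subgroup.map_top_of_surjective _ (QuotientGroup.mk'_surjective N)]

theorem commutator_quotient_ne_bot {G : Type*} [Group G] {N : Subgroup G} [N.Normal]
    (hN : ¬commutator G ≤ N) : commutator (G ⧸ N) ≠ ⊥ := by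
  rw [commutator_quotient_eq_map, Ne, Subgroup.map_eq_bot_iff, QuotientGroup.ker_mk']
  exact hN

theorem exists_monoidHom_apply_ne_one_of_notMem_commutator {G : Type*} [Group G] [Finite G] {g : G}
    (hg : g ∉ commutator G) : ∃ χ : G →* ℂˣ, χ g ≠ 1 := by
  have hg' : Abelianization.of g ≠ 1 := by
    rwa [Ne, ← MonoidHom.mem_ker, Abelianization.ker_of]
  have : NeZero (Monoid.exponent (Abelianization G)) := ⟨Monoid.exponent_ne_zero_of_finite⟩
  obtain ⟨χ, hχ⟩ := CommGroup.exists_apply_ne_one_of_hasEnoughRootsOfUnity (Abelianization G) ℂ hg'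
  exact ⟨χ.comp Abelianization.of, hχ⟩

theorem SameDegreePowerConj.le_commutator_of_not_commutator_le {G : Type*} [Group G] [Finite G]
    (h : SameDegreePowerConj G) {N : Subgroup G} [N.Normal] (hN : ¬commutator G ≤ N) :
    N ≤ commutator G := by
  intro x hx
  by_contra hxG
  obtain ⟨χ, hχ⟩ := exists_monoidHom_apply_ne_one_of_notMem_commutator hxG
  obtain ⟨d, ρ, hd0, hd, hρ⟩ :=
    exists_irreducible_ne_one_of_commutator_ne_bot (commutator_quotient_ne_bot hN)
  set τ := ρ.comp (QuotientGroup.mk' N)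
  have hτ : Submodule.span ℂ (Set.range τ) = ⊤ :=
    span_range_comp_eq_top hρ (QuotientGroup.mk'_surjective N)
  have hτN {y : G} (hy : y ∈ N) : τ y = 1 := by
    simp [τ, (QuotientGroup.eq_one_iff y).2 hy]
  -- The twist of `τ` by χ; comparing traces at `x` forces χ(x) = 1.
  let σ : G →* Matrix (Fin d) (Fin d) ℂ :=
    { toFun := fun g ↦ (χ g : ℂ) • τ g
      map_one' := by simp
      map_mul' := fun a b ↦ by simp [smul_smul, mul_comm] }
  have hσ : Submodule.span ℂ (Set.range σ) = ⊤ := by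
    rw [eq_top_iff, ← hτ, Submodule.span_le]
    rintro _ ⟨g, rfl⟩
    have : τ g = ((χ g)⁻¹ : ℂ) • σ g := by simp [σ, smul_smul]
    rw [this]
    exact Submodule.smul_mem _ _ (Submodule.subset_span ⟨g, rfl⟩)
  obtain ⟨k, -, hk⟩ := h d τ σ hd0 hd hτ hσ
  have h1 := hk x
  rw [hτN (pow_mem hx k)] at h1
  simp only [σ, MonoidHom.coe_mk, OneHom.coe_mk, hτN hx, Matrix.trace_smul, Matrix.trace_one,
    Fintype.card_fin, smul_eq_mul] at h1
  exact hχ (Units.ext (mul_right_cancel₀ (NeZero.ne (d : ℂ)) (h1.trans (one_mul _).symm)))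

/-! ### A cyclicity criterion and commutator identities -/

/-- The p-power map sends p^(k+1)-torsion to p^k-torsion with kernel of order at most p, which
bounds all p-power torsion; exponents prime to p are harmless. -/
theorem isCyclic_of_card_pow_prime_eq_one_le {A : Type*} [CommGroup A] [Finite A] {p : ℕ}
    [hp : Fact p.Prime] (hA : IsPGroup p A) (h : Nat.card (powMonoidHom p : A →* A).ker ≤ p) :
    IsCyclic A := by
  classical
  have := Fintype.ofFinite A
  have key (k : ℕ) : Nat.card (powMonoidHom (p ^ k) : A →* A).ker ≤ p ^ k := by
    induction k with
    | zero =>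
      have : (powMonoidHom (p ^ 0) : A →* A).ker = ⊥ := by
        ext x
        simp [MonoidHom.mem_ker]
      rw [this, Subgroup.card_bot, pow_zero]
    | succ k ih =>
      let φ := (powMonoidHom p : A →* A).comp (powMonoidHom (p ^ (k + 1)) : A →* A).ker.subtype
      rw [← φ.ker.card_mul_index, Subgroup.index_ker]
      refine le_trans ?_ (pow_succ' p k).ge
      refine Nat.mul_le_mul (le_trans ?_ h) (le_trans ?_ ih)
      · refine Nat.card_le_card_of_injective (fun x ↦ ⟨x.1.1, x.2⟩) fun x y hxy ↦ ?_
        exact Subtype.ext (Subtype.ext (congrArg (fun z : (powMonoidHom p : A →* A).ker ↦ (z : A)) hxy))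
      · refine Subgroup.card_le_of_le ?_
        rintro _ ⟨x, rfl⟩
        have := x.2
        rw [MonoidHom.mem_ker, powMonoidHom_apply] at this
        rw [MonoidHom.mem_ker, powMonoidHom_apply, MonoidHom.comp_apply, Subgroup.coe_subtype, powMonoidHom_apply,
          ← pow_mul, ← pow_succ', this]
  refine isCyclic_of_card_pow_eq_one_le fun n hn ↦ ?_
  obtain ⟨k, m, hm, rfl⟩ := Nat.exists_eq_pow_mul_and_not_dvd hn.ne' p hp.out.ne_one
  have hm' : p.Coprime m := (Nat.Prime.coprime_iff_not_dvd hp.out).2 hm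
  have hm0 : 0 < m := Nat.pos_of_ne_zero (by rintro rfl; simp at hm)
  refine le_trans ?_ (Nat.le_mul_of_pos_right _ hm0)
  refine le_trans (le_of_eq ?_) (key k)
  rw [Nat.card_eq_fintype_card, Fintype.card_subtype]
  congr 1
  ext x
  simp only [Finset.mem_filter, Finset.mem_univ, true_and, MonoidHom.mem_ker, powMonoidHom_apply]
  rw [pow_mul]
  refine ⟨fun hx ↦ (hA.powEquiv hm').injective ?_, fun hx ↦ by rw [hx, one_pow]⟩
  simpa using hx

theorem isCyclic_of_forall_mul_comm_of_card_pow_prime_eq_one_le {A : Type*} [Group A] [Finite A]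
    (hcomm : ∀ a b : A, a * b = b * a) {p : ℕ} [hp : Fact p.Prime] (hA : IsPGroup p A)
    (h : Nat.card {x : A // x ^ p = 1} ≤ p) : IsCyclic A := by
  let _ : CommGroup A := { ‹Group A› with mul_comm := hcomm }
  exact isCyclic_of_card_pow_prime_eq_one_le hA h

theorem pow_mem_center_of_commutatorElement {G : Type*} [Group G] {p : ℕ} {x : G}
    (hc : ∀ y : G, ⁅y, x⁆ ∈ Subgroup.center G) (hp : ∀ y : G, ⁅y, x⁆ ^ p = 1) :
    x ^ p ∈ Subgroup.center G := by
  refine Subgroup.mem_center_iff.2 fun y ↦ ?_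
  have h1 : y * x * y⁻¹ = ⁅y, x⁆ * x := by simp [commutatorElement_def]
  have h2 : y * x ^ p * y⁻¹ = x ^ p := by
    rw [← conj_pow, h1, Commute.mul_pow, hp, one_mul]
    exact (Subgroup.mem_center_iff.1 (hc y) x).symm
  exact mul_inv_eq_iff_eq_mul.1 h2

theorem commutatorElement_mem_commutator {G : Type*} [Group G] (a b : G) :
    ⁅a, b⁆ ∈ commutator G :=
  Subgroup.commutator_mem_commutator (Subgroup.mem_top a) (Subgroup.mem_top b)

theorem commutator_eq_bot_iff_forall_mul_comm {G : Type*} [Group G] :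
    commutator G = ⊥ ↔ ∀ a b : G, a * b = b * a := by
  rw [commutator_eq_bot_iff_center_eq_top, Subgroup.eq_top_iff']
  exact ⟨fun h a b ↦ Subgroup.mem_center_iff.1 (h b) a,
    fun h b ↦ Subgroup.mem_center_iff.2 fun a ↦ h a b⟩

/-! ### Reduction to p-groups -/

/-- Otherwise `f.ker` ≤ G', so `g` maps G' onto `Q`, making the nontrivial solvable group `Q`
perfect. -/
theorem commutator_le_ker_of_comparable {G P Q : Type*} [Group G] [Group P] [Group Q]
    [Nontrivial Q] [Group.IsSolvable Q]
    (h : ∀ N : Subgroup G, N.Normal → ¬commutator G ≤ N → N ≤ commutator G)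
    (f : G →* P) (g : G →* Q) (hfg : f.ker.map g = ⊤) : commutator G ≤ f.ker := by
  by_contra hf
  have h1 : commutator Q = ⊤ := by
    rw [eq_top_iff, ← hfg]
    refine (Subgroup.map_mono (h _ inferInstance hf)).trans ?_
    rw [commutator_def, Subgroup.map_commutator]
    exact Subgroup.commutator_mono le_top le_top
  exact (Group.IsSolvable.commutator_lt_top_of_nontrivial Q).ne h1

theorem exists_isPGroup_of_isNilpotent_of_comparable {G : Type*} [Group G] [Finite G]
    (hnil : Group.IsNilpotent G) (hG : commutator G ≠ ⊥)
    (h : ∀ N : Subgroup G, N.Normal → ¬commutator G ≤ N → N ≤ commutator G) :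
    ∃ p : ℕ, p.Prime ∧ IsPGroup p G := by
  classical
  by_contra! hp
  obtain ⟨e⟩ := (Group.isNilpotent_of_finite_tfae (G := G)).out 0 4 |>.1 hnil
  refine hG (commutator_eq_bot_iff_forall_mul_comm.2 fun a b ↦ e.symm.injective ?_)
  funext p P
  let proj (q : (Nat.card G).primeFactors) (Q : Sylow q G) : G →* Q :=
    ((Pi.evalMonoidHom _ Q).comp (Pi.evalMonoidHom _ q)).comp e.symm.toMonoidHom
  have hpp : (p : ℕ).Prime := Nat.prime_of_mem_primeFactors p.2
  obtain ⟨q, hq, hqG, hqp⟩ : ∃ q : ℕ, q.Prime ∧ q ∣ Nat.card G ∧ q ≠ p := by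
    by_contra! hq
    refine hp p hpp (IsPGroup.of_card (n := (Nat.card G).primeFactorsList.length)
      (Nat.eq_prime_pow_of_unique_prime_dvd Nat.card_pos.ne' fun {d} hd hdG ↦ hq d hd hdG))
  have : Fact q.Prime := ⟨hq⟩
  let q' : (Nat.card G).primeFactors :=
    ⟨q, Nat.mem_primeFactors.2 ⟨hq, hqG, Nat.card_pos.ne'⟩⟩
  obtain ⟨Q⟩ : Nonempty (Sylow q' G) := inferInstance
  have hQ : IsPGroup q Q := Q.isPGroup'
  have : Nontrivial Q := by
    rw [← Finite.one_lt_card_iff_nontrivial]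
    exact hq.one_lt.trans_le (Nat.le_of_dvd Nat.card_pos (Q.dvd_card_of_dvd_card hqG))
  have : Group.IsNilpotent Q := hQ.isNilpotent
  -- The factor `Q` lies in the kernel of the projection to `P`, so `P` is abelian.
  have hker := commutator_le_ker_of_comparable h (proj p P) (proj q' Q) (by
    refine (Subgroup.eq_top_iff' _).2 fun y ↦
      ⟨e (Pi.mulSingle q' (Pi.mulSingle Q y)), ?_, ?_⟩
    · have hne : p ≠ q' := fun hpq ↦ hqp (congrArg Subtype.val hpq).symm
      simp [proj, MonoidHom.mem_ker, Pi.mulSingle_eq_of_ne hne]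
    · simp [proj])
  have h1 := hker (commutatorElement_mem_commutator a b)
  rw [MonoidHom.mem_ker, map_commutatorElement, commutatorElement_eq_one_iff_mul_comm] at h1
  rw [map_mul, map_mul]
  exact h1

/-- Each character is a k-th power conjugate of a fixed one and depends only on the unit k modulo
the exponent. -/
theorem SameDegreePowerConj.card_le_totient_exponent {G : Type*} [Group G] [Finite G] (h : SameDegreePowerConj G) {ι : Type*}
    {d : ι → ℕ} {ρ : ∀ i, G →* Matrix (Fin (d i)) (Fin (d i)) ℂ} (hd : ∀ i, NeZero (d i))
    (hρ : ∀ i, Submodule.span ℂ (Set.range (ρ i)) = ⊤)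
    (hinj : ∀ i j, (∀ g, (ρ i g).trace = (ρ j g).trace) → i = j) {c : ℕ} (hc : c ≠ 1)
    {S : Finset ι} (hS : ∀ i ∈ S, d i = c) : S.card ≤ (Monoid.exponent G).totient := by
  classical
  obtain rfl | ⟨i₀, hi₀⟩ := S.eq_empty_or_nonempty
  · simp
  have key (a b : ℕ) (hab : a = b) (σ : G →* Matrix (Fin a) (Fin a) ℂ)
      (τ : G →* Matrix (Fin b) (Fin b) ℂ) (ha : NeZero a) (ha1 : a ≠ 1)
      (hσ : Submodule.span ℂ (Set.range σ) = ⊤) (hτ : Submodule.span ℂ (Set.range τ) = ⊤) :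
      ∃ k : ℕ, k.Coprime (Nat.card G) ∧ ∀ g, (τ g).trace = (σ (g ^ k)).trace := by
    subst hab
    exact h a σ τ ha ha1 hσ hτ
  have hex (i : ι) (hi : i ∈ S) := key (d i₀) (d i) ((hS i₀ hi₀).trans (hS i hi).symm) (ρ i₀) (ρ i)
    (hd i₀) (hS i₀ hi₀ ▸ hc) (hρ i₀) (hρ i)
  choose! k hk hk' using hex
  rw [Nat.totient]
  have he : 0 < Monoid.exponent G := Nat.pos_of_ne_zero Monoid.exponent_ne_zero_of_finite
  refine Finset.card_le_card_of_injOn (fun i ↦ k i % Monoid.exponent G) (fun i hi ↦ ?_)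
    fun i hi j hj hij ↦ ?_
  · have h1 := (hk i hi).coprime_dvd_right Group.exponent_dvd_nat_card
    simp only [Finset.coe_filter, Finset.mem_range, Set.mem_ofPred_eq]
    refine ⟨Nat.mod_lt _ he, ?_⟩
    rw [Nat.coprime_comm, Nat.Coprime, ← Nat.gcd_rec, Nat.gcd_comm]
    exact h1
  · refine hinj i j fun g ↦ ?_
    rw [hk' i hi, hk' j hj, Monoid.pow_eq_mod_exponent (n := k i), Monoid.pow_eq_mod_exponent (n := k j)]
    exact congrArg (fun n ↦ (ρ i₀ (g ^ n)).trace) hij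

/-- A subgroup of prime order in the center of a finite `p`-group. -/
theorem exists_mem_center_orderOf_eq {G : Type*} [Group G] [Finite G] {p : ℕ} [hp : Fact p.Prime] (hG : IsPGroup p G)
    [Nontrivial G] : ∃ x ∈ Subgroup.center G, orderOf x = p := by
  have := hG.center_nontrivial
  have h1 := (hG.to_subgroup (Subgroup.center G)).card_eq_or_dvd.resolve_left
    Finite.one_lt_card.ne'
  obtain ⟨x, hx⟩ := exists_prime_orderOf_dvd_card' p h1
  exact ⟨x, x.2, by rwa [Subgroup.orderOf_coe]⟩

theorem normal_zpowers_of_mem_center {G : Type*} [Group G] {x : G} (hx : x ∈ Subgroup.center G) :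
    (Subgroup.zpowers x).Normal :=
  ⟨fun n hn g ↦ by
    have := Subgroup.mem_center_iff.1 ((Subgroup.zpowers_le).2 hx hn) g
    rwa [this, mul_inv_cancel_right]⟩

/-! ### p-groups with commutator subgroup of order p -/

theorem mem_commutator_of_mem_center {G : Type*} [Group G] [Finite G] (h : SameDegreePowerConj G) {p : ℕ} [hp : Fact p.Prime]
    (hcard : Nat.card (commutator G) = p) {x : G} (hx : x ∈ Subgroup.center G) (hxp : x ^ p = 1) :
    x ∈ commutator G := by
  have := normal_zpowers_of_mem_center hx
  have hxx := Subgroup.mem_zpowers x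
  by_cases hle : commutator G ≤ Subgroup.zpowers x
  · rwa [Subgroup.eq_of_le_of_card_ge hle]
    rw [hcard, Nat.card_zpowers]
    exact Nat.le_of_dvd hp.out.pos (orderOf_dvd_of_pow_eq_one hxp)
  · exact h.le_commutator_of_not_commutator_le hle hxx

theorem isCyclic_center_of_card_commutator {G : Type*} [Group G] [Finite G] (h : SameDegreePowerConj G) {p : ℕ}
    [hp : Fact p.Prime] (hG : IsPGroup p G) (hcard : Nat.card (commutator G) = p) :
    IsCyclic (Subgroup.center G) := by
  refine isCyclic_of_forall_mul_comm_of_card_pow_prime_eq_one_le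
    (fun a b ↦ Subtype.ext (Subgroup.mem_center_iff.1 b.2 a)) (hG.to_subgroup _) ?_
  refine le_trans ?_ hcard.le
  refine Nat.card_le_card_of_injective (fun x ↦ ⟨x.1.1, mem_commutator_of_mem_center h hcard x.1.2 ?_⟩)
    fun x y hxy ↦ ?_
  · exact congrArg Subtype.val x.2
  · exact Subtype.ext (Subtype.ext (congrArg (fun z : commutator G ↦ (z : G)) hxy))

theorem commutator_le_center_of_card_commutator {G : Type*} [Group G] [Finite G] (h : SameDegreePowerConj G) {p : ℕ}
    [hp : Fact p.Prime] (hG : IsPGroup p G) (hcard : Nat.card (commutator G) = p) :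
    commutator G ≤ Subgroup.center G := by
  have : Nontrivial (commutator G) := Finite.one_lt_card_iff_nontrivial.1 (hcard ▸ hp.out.one_lt)
  have : Nontrivial G := (commutator G).nontrivial_iff_exists_ne_one.1 this |>.elim
    fun x hx ↦ ⟨x, 1, hx.2⟩
  obtain ⟨x, hx, hxp⟩ := exists_mem_center_orderOf_eq hG
  have h1 : Subgroup.zpowers x ≤ commutator G := (Subgroup.zpowers_le).2
    (mem_commutator_of_mem_center h hcard hx (hxp ▸ pow_orderOf_eq_one x))
  rw [← Subgroup.eq_of_le_of_card_ge h1 (by rw [hcard, Nat.card_zpowers, hxp])]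
  exact (Subgroup.zpowers_le).2 hx

theorem exists_eq_smul_one_of_mem_center {G : Type*} [Group G] {d : ℕ} {ρ : G →* Matrix (Fin d) (Fin d) ℂ}
    (hρ : Submodule.span ℂ (Set.range ρ) = ⊤) {z : G} (hz : z ∈ Subgroup.center G) :
    ∃ c : ℂ, ρ z = c • 1 :=
  exists_eq_smul_one_of_commute hρ fun g ↦ by
    rw [commute_iff_eq, ← map_mul, ← map_mul, Subgroup.mem_center_iff.1 hz g]

theorem eq_one_of_commutator_le_ker {G : Type*} [Group G] [Finite G] {d : ℕ} [NeZero d] {ρ : G →* Matrix (Fin d) (Fin d) ℂ}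
    (hρ : Submodule.span ℂ (Set.range ρ) = ⊤) (h : commutator G ≤ ρ.ker) : d = 1 := by
  have h1 := sq_le_index_of_forall_scalar hρ (K := ⊤) fun k _ ↦
    exists_eq_smul_one_of_commute hρ fun g ↦ by
      have h2 := h (commutatorElement_mem_commutator g k)
      have h3 : g * k = ⁅g, k⁆ * (k * g) := by simp [commutatorElement_def]
      rw [commute_iff_eq, ← map_mul, h3, map_mul, (h2 : ρ ⁅g, k⁆ = 1), one_mul, map_mul]
  rw [Subgroup.index_top] at h1
  have := NeZero.pos d
  nlinarith

/-- The character vanishes off the centre: for noncentral `x` some commutator acts as a scalar ζ ≠ 1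
and χ(x) = ζ χ(x). Only the centre contributes to the norm. -/
theorem sq_mul_card_center_of_card_commutator {G : Type*} [Group G] [Finite G] (h : SameDegreePowerConj G) {p : ℕ}
    [hp : Fact p.Prime] (hG : IsPGroup p G) (hcard : Nat.card (commutator G) = p) {d : ℕ}
    [NeZero d] (hd : d ≠ 1) {ρ : G →* Matrix (Fin d) (Fin d) ℂ}
    (hρ : Submodule.span ℂ (Set.range ρ) = ⊤) :
    d ^ 2 * Nat.card (Subgroup.center G) = Nat.card G := by
  classical
  have := Fintype.ofFinite G
  have hd0 : (d : ℂ) ≠ 0 := NeZero.ne _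
  have hzero (x : G) (hx : x ∉ Subgroup.center G) : (ρ x).trace = 0 := by
    obtain ⟨y, hy⟩ : ∃ y, y * x ≠ x * y := by simpa [Subgroup.mem_center_iff] using hx
    have hc := commutatorElement_mem_commutator y x
    have hc1 : ⁅y, x⁆ ≠ 1 := mt commutatorElement_eq_one_iff_mul_comm.1 hy
    obtain ⟨ζ, hζ⟩ := exists_eq_smul_one_of_mem_center hρ
      (commutator_le_center_of_card_commutator h hG hcard hc)
    have h1 : ζ * (ρ x).trace = (ρ x).trace := by
      have h2 : y * x * y⁻¹ = ⁅y, x⁆ * x := by simp [commutatorElement_def]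
      have h3 : (ρ (y * x * y⁻¹)).trace = (ρ x).trace := by
        rw [map_mul, Matrix.trace_mul_comm, ← map_mul]
        simp
      refine Eq.trans ?_ h3
      rw [h2, map_mul, hζ, Matrix.smul_mul, one_mul, Matrix.trace_smul, smul_eq_mul]
    by_contra hne
    have hζ1 : ζ = 1 := by
      refine mul_right_cancel₀ hne ?_
      rw [one_mul, h1]
    rw [hζ1, one_smul] at hζ
    refine hd (eq_one_of_commutator_le_ker hρ ?_)
    have h2 : Subgroup.zpowers ⁅y, x⁆ = commutator G := by
      refine Subgroup.eq_of_le_of_card_ge ((Subgroup.zpowers_le).2 hc) ?_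
      have h3 : Nat.card (Subgroup.zpowers ⁅y, x⁆) ∣ p :=
        hcard ▸ Subgroup.card_dvd_of_le ((Subgroup.zpowers_le).2 hc)
      rw [hcard]
      refine ((hp.out.eq_one_or_self_of_dvd _ h3).resolve_left fun h4 ↦ hc1 ?_).ge
      rwa [Nat.card_zpowers, orderOf_eq_one_iff] at h4
    rw [← h2, Subgroup.zpowers_le]
    exact hζ
  have hcen (x : G) (hx : x ∈ Subgroup.center G) : (ρ x).trace * (ρ x⁻¹).trace = d ^ 2 := by
    obtain ⟨a, ha⟩ := exists_eq_smul_one_of_mem_center hρ hx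
    obtain ⟨b, hb⟩ := exists_eq_smul_one_of_mem_center hρ (inv_mem hx)
    have hab : a * b * d = d := by
      have h1 : ρ x * ρ x⁻¹ = 1 := by rw [← map_mul, mul_inv_cancel, map_one]
      rw [ha, hb, Matrix.smul_mul, one_mul, smul_smul] at h1
      simpa using congrArg Matrix.trace h1
    rw [ha, hb, Matrix.trace_smul, Matrix.trace_smul, Matrix.trace_one, Fintype.card_fin,
      smul_eq_mul, smul_eq_mul]
    linear_combination (d : ℂ) * hab
  have hsum := sum_trace_mul_trace_inv hρ
  have hterm (x : G) : (ρ x).trace * (ρ x⁻¹).trace =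
      if x ∈ Subgroup.center G then (d : ℂ) ^ 2 else 0 := by
    split_ifs with hx
    · exact hcen x hx
    · rw [hzero x hx, zero_mul]
  simp only [hterm] at hsum
  rw [← Finset.sum_filter, Finset.sum_const, nsmul_eq_mul, ← Nat.card_eq_fintype_card] at hsum
  have h1 : (Finset.univ.filter (· ∈ Subgroup.center G)).card = Nat.card (Subgroup.center G) := by
    rw [← Fintype.card_subtype, ← Nat.card_eq_fintype_card]
  rw [h1] at hsum
  rw [mul_comm]
  exact_mod_cast hsum

/-! ### Counting characters over a central subgroup of order p -/

theorem mul_sum_range_pow_lt {p : ℕ} (hp : 2 ≤ p) (n : ℕ) :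
    p * ∑ a ∈ Finset.range n, (p ^ a) ^ 2 < (p ^ n) ^ 2 := by
  induction n with
  | zero => simp
  | succ n ih =>
    rw [Finset.sum_range_succ, mul_add, pow_succ p n, mul_pow]
    have : (p ^ n) ^ 2 * (p + 1) ≤ (p ^ n) ^ 2 * p ^ 2 := Nat.mul_le_mul_left _ (by nlinarith)
    linarith

section CentralQuotient

variable {G : Type*} [Group G] [Finite G] {p : ℕ} [hp : Fact p.Prime] {M : Subgroup G} [M.Normal]

/-- If `x` lifts a generator of Z(G/M), then x^p is central, so the preimage is covered by the p
cosets x^i Z(G), 0 ≤ i < p. -/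
theorem card_comap_center_le (hM : Nat.card M = p) (hMZ : M ≤ Subgroup.center G)
    (hcyc : IsCyclic (Subgroup.center (G ⧸ M))) :
    Nat.card ((Subgroup.center (G ⧸ M)).comap (QuotientGroup.mk' M)) ≤
      p * Nat.card (Subgroup.center G) := by
  obtain ⟨⟨q, hq⟩, hgen⟩ := hcyc.exists_generator
  obtain ⟨x, rfl⟩ := QuotientGroup.mk'_surjective M q
  have hcM (y : G) : ⁅y, x⁆ ∈ M := by
    rw [← QuotientGroup.eq_one_iff, ← QuotientGroup.mk'_apply, map_commutatorElement,
      commutatorElement_eq_one_iff_mul_comm]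
    exact Subgroup.mem_center_iff.1 hq _
  have hxp : x ^ p ∈ Subgroup.center G :=
    pow_mem_center_of_commutatorElement (fun y ↦ hMZ (hcM y)) fun y ↦ by
      have := pow_card_eq_one' (x := (⟨_, hcM y⟩ : M))
      rw [hM] at this
      exact congrArg Subtype.val this
  have hx : x ∈ (Subgroup.center (G ⧸ M)).comap (QuotientGroup.mk' M) := hq
  have hle : Subgroup.center G ≤ (Subgroup.center (G ⧸ M)).comap (QuotientGroup.mk' M) := by
    intro z hz
    refine Subgroup.mem_center_iff.2 fun y ↦ ?_
    obtain ⟨g, rfl⟩ := QuotientGroup.mk'_surjective M y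
    rw [← map_mul, ← map_mul, Subgroup.mem_center_iff.1 hz]
  calc Nat.card ((Subgroup.center (G ⧸ M)).comap (QuotientGroup.mk' M))
      ≤ Nat.card (Fin p × Subgroup.center G) := by
        refine Nat.card_le_card_of_surjective
          (fun a ↦ ⟨x ^ (a.1 : ℕ) * a.2, mul_mem (pow_mem hx _) (hle a.2.2)⟩) fun w ↦ ?_
        obtain ⟨k, hk⟩ := hgen ⟨QuotientGroup.mk' M w, w.2⟩
        have hk' : QuotientGroup.mk' M (x ^ k) = QuotientGroup.mk' M w := by
          rw [map_zpow]
          exact congrArg Subtype.val hk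
        have hm : (x ^ k)⁻¹ * w ∈ M := QuotientGroup.eq.1 hk'
        have hp0 : (0 : ℤ) < p := by exact_mod_cast hp.out.pos
        have h0 := Int.emod_nonneg k hp0.ne'
        have hlt := Int.emod_lt_of_pos k hp0
        refine ⟨⟨⟨(k % p).toNat, by omega⟩, ⟨(x ^ p) ^ (k / p) * ((x ^ k)⁻¹ * w),
          mul_mem (zpow_mem hxp _) (hMZ hm)⟩⟩, Subtype.ext ?_⟩
        change x ^ (k % p).toNat * ((x ^ p) ^ (k / p) * ((x ^ k)⁻¹ * w)) = w
        rw [← zpow_natCast, ← zpow_natCast, Int.toNat_of_nonneg h0, ← zpow_mul, ← mul_assoc,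
          ← zpow_add, Int.emod_add_mul_ediv, mul_inv_cancel_left]
    _ = p * Nat.card (Subgroup.center G) := by rw [Nat.card_prod, Nat.card_fin]

theorem exponent_dvd_of_card_commutator_quotient (h : SameDegreePowerConj (G ⧸ M))
    (hG : IsPGroup p G) (hcard : Nat.card (commutator (G ⧸ M)) = p) :
    Monoid.exponent G ∣
      p * Nat.card ((Subgroup.center (G ⧸ M)).comap (QuotientGroup.mk' M)) := by
  refine Monoid.exponent_dvd_of_forall_pow_eq_one fun g ↦ ?_
  have hg : g ^ p ∈ (Subgroup.center (G ⧸ M)).comap (QuotientGroup.mk' M) := by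
    rw [Subgroup.mem_comap, map_pow]
    refine pow_mem_center_of_commutatorElement (fun y ↦ commutator_le_center_of_card_commutator h
      (hG.to_quotient M) hcard (commutatorElement_mem_commutator _ _)) fun y ↦ ?_
    have := pow_card_eq_one' (x := (⟨_, commutatorElement_mem_commutator y (QuotientGroup.mk' M g)⟩ :
      commutator (G ⧸ M)))
    rw [hcard] at this
    exact congrArg Subtype.val this
  rw [pow_mul]
  exact congrArg Subtype.val (pow_card_eq_one' (x := (⟨_, hg⟩ : Subgroup.comap _ _)))

omit [Finite G] in
-- A power conjugate of an inflated character takes the value d on `M`, where `ρ` is scalar.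
theorem le_ker_of_comp_mk' (h : SameDegreePowerConj G) (hMZ : M ≤ Subgroup.center G) {d : ℕ}
    [NeZero d] (hd : d ≠ 1) {ρ : G →* Matrix (Fin d) (Fin d) ℂ}
    (hρ : Submodule.span ℂ (Set.range ρ) = ⊤) {σ : G ⧸ M →* Matrix (Fin d) (Fin d) ℂ}
    (hσ : Submodule.span ℂ (Set.range σ) = ⊤) : M ≤ ρ.ker := by
  intro x hx
  obtain ⟨k, -, hk⟩ := h d (σ.comp (QuotientGroup.mk' M)) ρ inferInstance hd
    (span_range_comp_eq_top hσ (QuotientGroup.mk'_surjective M)) hρ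
  obtain ⟨c, hc⟩ := exists_eq_smul_one_of_mem_center hρ (hMZ hx)
  have h1 := hk x
  rw [MonoidHom.comp_apply, QuotientGroup.mk'_apply, (QuotientGroup.eq_one_iff _).2 (pow_mem hx k),
    map_one, hc, Matrix.trace_smul, Matrix.trace_one, Fintype.card_fin, smul_eq_mul] at h1
  have hc1 : c = 1 := mul_right_cancel₀ (NeZero.ne (d : ℂ)) (h1.trans (one_mul _).symm)
  rw [MonoidHom.mem_ker, hc, hc1, one_smul]

/-- A `p`-group with `SameDegreePowerConj` has no central subgroup `M` of order `p` inside the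
commutator subgroup such that the commutator subgroup of `G ⧸ M` has order `p`: the irreducible
characters nontrivial on `M` would be too few and of too small degree. -/
theorem false_of_card_commutator_quotient (h : SameDegreePowerConj G) (hG : IsPGroup p G)
    (hM : Nat.card M = p) (hMZ : M ≤ Subgroup.center G) (hMG : M ≤ commutator G)
    (hcard : Nat.card (commutator (G ⧸ M)) = p) : False := by
  classical
  have hH := h.quotient M
  have hHp := hG.to_quotient M
  have hp2 := hp.out.two_le
  obtain ⟨t, ht⟩ := IsPGroup.iff_card.1 (hHp.to_subgroup (Subgroup.center (G ⧸ M)))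
  have hGM : Nat.card G = Nat.card (G ⧸ M) * p := by
    rw [Subgroup.card_eq_card_quotient_mul_card_subgroup M, hM]
  obtain ⟨d₀, σ, hd₀, hd₀1, hσ⟩ := exists_irreducible_ne_one_of_commutator_ne_bot
    (G := G ⧸ M) fun hbot ↦ by
      rw [hbot, Subgroup.card_bot] at hcard
      exact hp.out.ne_one hcard.symm
  have hHcard := sq_mul_card_center_of_card_commutator hH hHp hcard hd₀1 hσ
  obtain ⟨n, hn⟩ : ∃ n, d₀ = p ^ n := by
    obtain ⟨s, hs⟩ := IsPGroup.iff_card.1 hHp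
    obtain ⟨n, -, hn⟩ := (Nat.dvd_prime_pow hp.out).1 (hs ▸ dvd_card_of_span_eq_top hσ)
    exact ⟨n, hn⟩
  have hcomap : Nat.card ((Subgroup.center (G ⧸ M)).comap (QuotientGroup.mk' M)) =
      p ^ (t + 1) := by
    have h1 := ((Subgroup.center (G ⧸ M)).comap (QuotientGroup.mk' M)).card_mul_index
    rw [Subgroup.index_comap_of_surjective _ (QuotientGroup.mk'_surjective M), hGM,
      ← (Subgroup.center (G ⧸ M)).card_mul_index, ht] at h1
    have h2 : 0 < (Subgroup.center (G ⧸ M)).index :=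
      Nat.pos_of_ne_zero Subgroup.index_ne_zero_of_finite
    refine Nat.eq_of_mul_eq_mul_right h2 (h1.trans ?_)
    ring
  have hindex : (Subgroup.center G).index ≤ p * d₀ ^ 2 := by
    have h1 := card_comap_center_le hM hMZ (isCyclic_center_of_card_commutator hH hHp hcard)
    rw [hcomap] at h1
    have h2 := (Subgroup.center G).card_mul_index
    rw [hGM, ← hHcard, ht] at h2
    refine Nat.le_of_mul_le_mul_left ?_ (Nat.card_pos (α := Subgroup.center G))
    rw [h2]
    calc d₀ ^ 2 * p ^ t * p = p ^ (t + 1) * d₀ ^ 2 := by ring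
      _ ≤ p * Nat.card (Subgroup.center G) * d₀ ^ 2 := Nat.mul_le_mul_right _ h1
      _ = _ := by ring
  -- p-th powers land in the preimage of Z(G/M), of order p^(t+1), so the exponent divides p^(t+2).
  have htot : (Monoid.exponent G).totient ≤ p ^ (t + 1) * (p - 1) := by
    have h1 := exponent_dvd_of_card_commutator_quotient hH hG hcard
    rw [hcomap, ← pow_succ'] at h1
    rw [← Nat.totient_prime_pow_succ hp.out]
    exact Nat.le_of_dvd (Nat.totient_pos.2 (pow_pos hp.out.pos _)) (Nat.totient_dvd_of_dvd h1)
  obtain ⟨m, d, ρ, hd, hρ, hinj, hsum, hle⟩ := exists_complete_irreducible_family G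
  set T := Finset.univ.filter fun i ↦ ¬M ≤ (ρ i).ker
  have hTsum : p ^ t * d₀ ^ 2 * (p - 1) ≤ ∑ i ∈ T, d i ^ 2 := by
    have h1 := hle M (Finset.univ.filter fun i ↦ M ≤ (ρ i).ker) fun i hi ↦
      (Finset.mem_filter.1 hi).2
    have h2 := Finset.sum_filter_add_sum_filter_not Finset.univ (fun i ↦ M ≤ (ρ i).ker)
      fun i ↦ d i ^ 2
    rw [hsum, hGM, ← hHcard, ht] at h2
    rw [Subgroup.index, ← hHcard, ht] at h1
    obtain ⟨r, rfl⟩ : ∃ r, p = r + 1 := ⟨p - 1, by omega⟩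
    rw [Nat.add_sub_cancel]
    nlinarith
  have hdT (i : Fin m) (hi : i ∈ T) : d i ≠ 1 ∧ ∃ a < n, d i = p ^ a := by
    have hker : ¬M ≤ (ρ i).ker := (Finset.mem_filter.1 hi).2
    have hd1 : d i ≠ 1 := fun hd1 ↦ hker (hMG.trans (commutator_le_ker_of_eq_one hd1 (ρ i)))
    refine ⟨hd1, ?_⟩
    obtain ⟨s, hs⟩ := IsPGroup.iff_card.1 hG
    have := hd i
    obtain ⟨a, -, ha⟩ := (Nat.dvd_prime_pow hp.out).1 (hs ▸ dvd_card_of_span_eq_top (hρ i))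
    refine ⟨a, ?_, ha⟩
    have hne : a ≠ n := by
      rintro rfl
      obtain rfl : d₀ = d i := hn.trans ha.symm
      exact hker (le_ker_of_comp_mk' h hMZ hd1 (hρ i) hσ)
    have h1 := (sq_le_index_of_forall_scalar (hρ i) (K := Subgroup.center G) fun z hz ↦
      exists_eq_smul_one_of_mem_center (hρ i) hz).trans hindex
    -- Here p^(2a) ≤ p^(2n+1); by parity a ≤ n, and a = n is excluded.
    rw [ha, hn, ← pow_mul, ← pow_mul, ← pow_succ', Nat.pow_le_pow_iff_right hp.out.one_lt] at h1
    omega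
  have hfib : ∑ i ∈ T, d i ^ 2 ≤
      ∑ a ∈ Finset.range n, p ^ (t + 1) * (p - 1) * (p ^ a) ^ 2 := by
    choose! hd1 a ha ha' using hdT
    rw [← Finset.sum_fiberwise_of_maps_to (g := a) (t := Finset.range n) fun i hi ↦
      Finset.mem_range.2 (ha i hi)]
    refine Finset.sum_le_sum fun b _ ↦ ?_
    have hfd (i : Fin m) (hi : i ∈ T.filter fun i ↦ a i = b) : d i = p ^ b := by
      rw [ha' i (Finset.mem_filter.1 hi).1, (Finset.mem_filter.1 hi).2]
    rw [Finset.sum_congr rfl fun i hi ↦ by rw [hfd i hi], Finset.sum_const, smul_eq_mul]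
    refine Nat.mul_le_mul_right _ ?_
    -- A member of the fibre is needed to know p^b ≠ 1, as the counting bound requires.
    obtain hempty | ⟨i, hi⟩ := (T.filter fun i ↦ a i = b).eq_empty_or_nonempty
    · rw [hempty]
      exact Nat.zero_le _
    · exact (h.card_le_totient_exponent hd hρ hinj
        (hfd i hi ▸ hd1 i (Finset.mem_filter.1 hi).1) hfd).trans htot
  have hfin := hTsum.trans hfib
  rw [← Finset.mul_sum, hn] at hfin
  have hlt := mul_sum_range_pow_lt hp2 n
  have hpos : 0 < p ^ t * (p - 1) := Nat.mul_pos (pow_pos hp.out.pos _) (by omega)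
  refine absurd hfin (not_le.2 ?_)
  calc _ = p ^ t * (p - 1) * (p * ∑ a ∈ Finset.range n, (p ^ a) ^ 2) := by ring
    _ < p ^ t * (p - 1) * (p ^ n) ^ 2 := Nat.mul_lt_mul_of_pos_left hlt hpos
    _ = _ := by ring

end CentralQuotient

/-! ### Induction on the group order and conclusion -/

theorem card_commutator_eq_of_sameDegreePowerConj {p : ℕ} [hp : Fact p.Prime] (n : ℕ) :
    ∀ (G : Type*) [Group G] [Finite G], Nat.card G = n → IsPGroup p G → SameDegreePowerConj G →
      commutator G ≠ ⊥ → Nat.card (commutator G) = p := by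
  induction n using Nat.strong_induction_on with
  | _ n ih =>
  intro G _ _ hn hG h hne
  have : Nontrivial G := by
    obtain ⟨x, hx⟩ := Subgroup.ne_bot_iff_exists_ne_one.1 hne
    exact ⟨x, 1, fun h1 ↦ hx (Subtype.ext h1)⟩
  obtain ⟨x, hx, hxp⟩ := exists_mem_center_orderOf_eq hG
  have := normal_zpowers_of_mem_center hx
  have hM : Nat.card (Subgroup.zpowers x) = p := by rw [Nat.card_zpowers, hxp]
  by_cases hle : commutator G ≤ Subgroup.zpowers x
  · refine (hp.out.eq_one_or_self_of_dvd _ (hM ▸ Subgroup.card_dvd_of_le hle)).resolve_left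
      fun h1 ↦ hne (Subgroup.eq_bot_of_card_le _ h1.le)
  · refine (false_of_card_commutator_quotient h hG hM ((Subgroup.zpowers_le).2 hx)
      (h.le_commutator_of_not_commutator_le hle) ?_).elim
    refine ih _ ?_ _ rfl (hG.to_quotient _) (h.quotient _) (commutator_quotient_ne_bot hle)
    rw [← hn, Subgroup.card_eq_card_quotient_mul_card_subgroup (Subgroup.zpowers x), hM]
    exact lt_mul_of_one_lt_right Nat.card_pos hp.out.one_lt

theorem corollary3p2 {G : Type*} [Group G] [Finite G] (hnil : Group.IsNilpotent G)
    (hGC : IsGCStar G) :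
    (∀ a b : G, a * b = b * a) ∨
      ∃ p : ℕ, p.Prime ∧ IsPGroup p G ∧ IsCyclic (Subgroup.center G) ∧
        (Nat.card (commutator G)).Prime := by
  refine or_iff_not_imp_left.2 fun hab ↦ ?_
  have hne : commutator G ≠ ⊥ := mt commutator_eq_bot_iff_forall_mul_comm.1 hab
  have h := hGC.sameDegreePowerConj
  obtain ⟨p, hp, hG⟩ := exists_isPGroup_of_isNilpotent_of_comparable hnil hne fun N _ hN ↦
    h.le_commutator_of_not_commutator_le hN
  have : Fact p.Prime := ⟨hp⟩
  have hcard := card_commutator_eq_of_sameDegreePowerConj _ G rfl hG h hne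
  exact ⟨p, hp, hG, isCyclic_center_of_card_commutator h hG hcard, hcard ▸ hp⟩
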